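/- **Conventions.** All algebras are associative algebras over $\mathbb C$, not necessarily unital or commutative. A *uniform seminorm* on an algebra $E$ is a seminorm $p$ with $p(xy)\le p(x)p(y)$ and $p(x^2)=p(x)^2$ for all $x,y\in E$. A *uniform topological algebra* $(E,(p_\alpha)_{\alpha\in\Lambda})$ is an algebra $E$ with a Hausdorff topology determined by a directed family of uniform seminorms $p_\alpha$, where $\alpha\le\beta$ means $p_\alpha\le p_\beta$ pointwise on $E$. Its factors are the normed algebras $E_\alpha=E/\ker p_\alpha$ with norm $\|x+\ker p_\alpha\|=p_\alpha(x)$; let $f_\alpha:E\to E_\alpha$ be the quotient maps and, for $\alpha\le\beta$, let $f_{\alpha\beta}:E_\beta\to E_\alpha$ be the homomorphism $x+\ker p_\beta\mapsto x+\ker p_\alpha$. A *multiplier* of an algebra $A$ is a map $T:A\to A$ (not assumed linear or continuous) with $T(x)y=xT(y)$ for all $x,y\in A$, and $M(A)$ is the set of all multipliers of $A$. For $A=E$ and $A=E_\alpha$ as above, every multiplier is linear, and $M(A)$ is a commutative unital algebra under the pointwise linear operations and composition. Every $T\in M(E)$ induces a unique $T_\alpha\in M(E_\alpha)$ with $T_\alpha\circ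 f_\alpha=f_\alpha\circ T$, and for $\alpha\le\beta$ every $U\in M(E_\beta)$ induces a unique $h_{\alpha\beta}(U)\in M(E_\alpha)$ with $h_{\alpha\beta}(U)\circ f_{\alpha\beta}=f_{\alpha\beta}\circ U$. The maps $h_{\alpha\beta}$ are algebra homomorphisms, and $$\varprojlim M(E_\alpha)=\Big\{(U_\alpha)_\alpha\in\prod_{\alpha} M(E_\alpha): h_{\alpha\beta}(U_\beta)=U_\alpha\text{ for all }\alpha\le\beta\Big\}.$$ **Theorem 2.9.** Let $(E,(p_\alpha)_{\alpha\in\Lambda})$ be a complete uniform topological algebra. Then $\varphi(T)=(T_\alpha)_{\alpha\in\Lambda}$ defines an algebra isomorphism $\varphi:M(E)\to\varprojlim M(E_\alpha)$. If moreover each factor $E_\alpha$ is complete, then every multiplier of $E$ is continuous, and $\varphi$ is a topological algebra isomorphism (an algebra isomorphism that is also a homeomorphism), where $M(E)$ carries the topology defined by the seminorms $T\mapsto\|T_\alpha\|_\alpha$, $\alpha\in\Lambda$, with $\|\cdot\|_\alpha$ the operator norm on $M(E_\alpha)$ (all multipliers of $E_\alpha$ are then bounded), and $\varprojlim M(E_\alpha)$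 carries the topology induced by the product of the operator norm topologies. -/

import Mathlib

set_option linter.unusedSectionVars false

noncomputable section

/-! ### Multipliers -/

/-- An algebra `A` is proper if `xA = Ax = {0}` implies `x = 0`. -/
class IsProperAlgebra (A : Type*) [NonUnitalRing A] : Prop where
  eq_zero_of_mul (x : A) : (∀ y : A, x * y = 0) → (∀ y : A, y * x = 0) → x = 0

/-- A ring in which squares of nonzero elements are nonzero is proper. -/
theorem IsProperAlgebra.of_mul_self {A : Type*} [NonUnitalRing A]
    (h : ∀ x : A, x * x = 0 → x = 0) : IsProperAlgebra A :=
  ⟨fun x hx _ => h x (hx x)⟩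

/-- `M(A)`: the set of all maps `T : A → A` with `T(x) y = x T(y)` for all `x, y`. No linearity and
no continuity is required. -/
structure Multiplier (A : Type*) [NonUnitalRing A] where
  /-- the underlying map -/
  toFun : A → A
  map_mul' : ∀ x y : A, toFun x * y = x * toFun y

namespace Multiplier

section Algebraic

variable {A : Type*} [NonUnitalRing A]

instance : FunLike (Multiplier A) A A where
  coe := Multiplier.toFun
  coe_injective := by
    rintro ⟨f, hf⟩ ⟨g, hg⟩ h
    simpa using h

@[simp] theorem coe_mk (f : A → A) (h : ∀ x y, f x * y = x * f y) (x : A) :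
    (Multiplier.mk f h) x = f x := rfl

@[ext] theorem ext {S T : Multiplier A} (h : ∀ x, S x = T x) : S = T := DFunLike.ext _ _ h

theorem mul_comm' (T : Multiplier A) (x y : A) : T x * y = x * T y := T.map_mul' x y

variable [IsProperAlgebra A]

theorem eq_of_mul {a b : A} (h₁ : ∀ z, a * z = b * z) (h₂ : ∀ z, z * a = z * b) : a = b :=
  sub_eq_zero.1 <| IsProperAlgebra.eq_zero_of_mul _
    (fun z => by rw [sub_mul, h₁, sub_self]) (fun z => by rw [mul_sub, h₂, sub_self])

theorem map_add' (T : Multiplier A) (x y : A) : T (x + y) = T x + T y :=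
  eq_of_mul
    (fun z => by rw [mul_comm', add_mul, add_mul, mul_comm', mul_comm'])
    (fun z => by rw [← mul_comm', mul_add, mul_add, ← mul_comm', ← mul_comm'])

theorem map_mul_right (T : Multiplier A) (x y : A) : T (x * y) = x * T y :=
  eq_of_mul
    (fun z => by rw [mul_comm', mul_assoc, mul_assoc, ← mul_comm'])
    (fun z => by
      rw [← mul_comm', ← mul_assoc, mul_comm' T z x, mul_assoc, mul_comm' T x y])

theorem map_mul_left (T : Multiplier A) (x y : A) : T (x * y) = T x * y := by
  rw [map_mul_right, mul_comm']

theorem apply_mul_apply (S T : Multiplier A) (x y : A) : S x * T y = T x * S y := by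
  rw [← map_mul_right, mul_comm' S x y, map_mul_left]

theorem apply_apply_comm (S T : Multiplier A) (x : A) : S (T x) = T (S x) :=
  eq_of_mul
    (fun z => by rw [mul_comm' S (T x) z, mul_comm' T (S x) z, apply_mul_apply])
    (fun z => by rw [← mul_comm' S z (T x), ← mul_comm' T z (S x), apply_mul_apply])

instance : Zero (Multiplier A) := ⟨⟨fun _ => 0, fun x y => by simp⟩⟩
instance : One (Multiplier A) := ⟨⟨fun x => x, fun _ _ => rfl⟩⟩
instance : Add (Multiplier A) :=
  ⟨fun S T => ⟨fun x => S x + T x, fun x y => by rw [add_mul, mul_add, mul_comm', mul_comm']⟩⟩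
instance : Neg (Multiplier A) :=
  ⟨fun T => ⟨fun x => -T x, fun x y => by rw [neg_mul, mul_neg, mul_comm']⟩⟩
instance : Mul (Multiplier A) :=
  ⟨fun S T => ⟨fun x => S (T x), fun x y => by rw [mul_comm', mul_comm', apply_apply_comm]⟩⟩

/-- Multipliers of a proper algebra form a commutative ring: pointwise addition, composition as
multiplication, the identity map as `1`. -/
instance : CommRing (Multiplier A) where
  add_assoc _ _ _ := ext fun _ => add_assoc _ _ _
  zero_add _ := ext fun _ => zero_add _
  add_zero _ := ext fun _ => add_zero _
  add_comm _ _ := ext fun _ => add_comm _ _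
  neg_add_cancel _ := ext fun _ => neg_add_cancel _
  mul_assoc _ _ _ := rfl
  one_mul _ := rfl
  mul_one _ := rfl
  mul_comm S T := ext fun x => apply_apply_comm S T x
  left_distrib R S T := ext fun x => map_add' R (S x) (T x)
  right_distrib _ _ _ := rfl
  zero_mul _ := rfl
  mul_zero S := ext fun x => by
    have h := map_add' S 0 0
    rw [add_zero] at h
    exact left_eq_add.1 h
  nsmul := nsmulRec
  zsmul := zsmulRec

@[simp] theorem zero_apply (x : A) : (0 : Multiplier A) x = 0 := rfl
@[simp] theorem one_apply (x : A) : (1 : Multiplier A) x = x := rfl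
@[simp] theorem add_apply (S T : Multiplier A) (x : A) : (S + T) x = S x + T x := rfl
@[simp] theorem neg_apply (T : Multiplier A) (x : A) : (-T) x = -T x := rfl
@[simp] theorem mul_apply (S T : Multiplier A) (x : A) : (S * T) x = S (T x) := rfl

variable [Module ℂ A] [IsScalarTower ℂ A A] [SMulCommClass ℂ A A]

theorem map_smul' (T : Multiplier A) (c : ℂ) (x : A) : T (c • x) = c • T x :=
  eq_of_mul
    (fun z => by rw [mul_comm', smul_mul_assoc, smul_mul_assoc, mul_comm'])
    (fun z => by rw [← mul_comm', mul_smul_comm, mul_smul_comm, ← mul_comm'])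

instance : SMul ℂ (Multiplier A) where
  smul c T := ⟨fun x => c • T x, fun x y => by rw [smul_mul_assoc, mul_smul_comm, mul_comm']⟩

@[simp] theorem smul_apply (c : ℂ) (T : Multiplier A) (x : A) : (c • T) x = c • T x := rfl

instance : Module ℂ (Multiplier A) where
  one_smul _ := ext fun _ => one_smul _ _
  mul_smul _ _ _ := ext fun _ => mul_smul _ _ _
  smul_zero _ := ext fun _ => smul_zero _
  smul_add _ _ _ := ext fun _ => smul_add _ _ _
  add_smul _ _ _ := ext fun _ => add_smul _ _ _
  zero_smul _ := ext fun _ => zero_smul _ _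

/-- The algebra of multipliers of a proper algebra. -/
instance : Algebra ℂ (Multiplier A) :=
  Algebra.ofModule (fun _ _ _ => rfl) (fun c S T => ext fun x => map_smul' S c (T x))

/-- A multiplier of a proper algebra as a linear map. -/
def toLinearMap (T : Multiplier A) : A →ₗ[ℂ] A where
  toFun := T
  map_add' := map_add' T
  map_smul' := map_smul' T

end Algebraic

section Pushforward

variable {A B : Type*} [NonUnitalRing A] [IsProperAlgebra A] [Module ℂ A] [IsScalarTower ℂ A A]
  [SMulCommClass ℂ A A] [NonUnitalRing B] [IsProperAlgebra B] [Module ℂ B] [IsScalarTower ℂ B B]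
  [SMulCommClass ℂ B B]

theorem map_eq_of_map_eq (f : A →ₙₐ[ℂ] B) (hB : ∀ y : B, y * y = 0 → y = 0) (U : Multiplier A)
    {x x' : A} (h : f x = f x') : f (U x) = f (U x') := by
  have hk : ∀ z : A, f z = 0 → f (U z) = 0 := fun z hz => hB _ <| by
    rw [← map_mul, mul_comm', map_mul, hz, zero_mul]
  have h1 : U x = U (x - x') + U x' := by rw [← map_add', sub_add_cancel]
  rw [h1, map_add, hk _ (by rw [map_sub, h, sub_self]), zero_add]

/-- For a surjective homomorphism `f : A → B` onto an algebra without nonzero elements of square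
zero, every multiplier `U` of `A` induces the unique multiplier `V` of `B` with `V ∘ f = f ∘ U`
(see `pushforward_apply`); `U ↦ V` is an algebra homomorphism `M(A) → M(B)`. -/
def pushforward (f : A →ₙₐ[ℂ] B) (hf : Function.Surjective f)
    (hB : ∀ y : B, y * y = 0 → y = 0) : Multiplier A →ₐ[ℂ] Multiplier B :=
  have key : ∀ (U : Multiplier A) (x : A),
      f (U (Function.surjInv hf (f x))) = f (U x) := fun U x =>
    map_eq_of_map_eq f hB U (Function.surjInv_eq hf (f x))
  AlgHom.ofLinearMap
    { toFun := fun U =>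
        { toFun := fun y => f (U (Function.surjInv hf y))
          map_mul' := by
            intro y y'
            obtain ⟨x, rfl⟩ := hf y
            obtain ⟨x', rfl⟩ := hf y'
            rw [key, key, ← map_mul, ← map_mul, mul_comm'] }
      map_add' := fun U V => ext fun y => by simp
      map_smul' := fun c U => ext fun y => by simp }
    (ext fun y => by simp [Function.surjInv_eq])
    (fun U V => ext fun y => by simp [key])

@[simp] theorem pushforward_apply (f : A →ₙₐ[ℂ] B) (hf : Function.Surjective f)
    (hB : ∀ y : B, y * y = 0 → y = 0) (U : Multiplier A) (x : A) :
    pushforward f hf hB U (f x) = f (U x) :=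
  map_eq_of_map_eq f hB U (Function.surjInv_eq hf (f x))

end Pushforward

section Banach

variable {A : Type*} [NonUnitalNormedRing A] [IsProperAlgebra A] [NormedSpace ℂ A]
  [IsScalarTower ℂ A A] [SMulCommClass ℂ A A] [CompleteSpace A]

/-- A multiplier of a proper Banach algebra is continuous, so that it has an operator norm. -/
theorem continuous_of_completeSpace (T : Multiplier A) : Continuous T := by
  have hg : Continuous (toLinearMap T) := by
    refine LinearMap.continuous_of_seq_closed_graph (g := toLinearMap T) fun u x y hu hTu => ?_
    refine eq_of_mul (fun z => ?_) (fun z => ?_)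
    · refine tendsto_nhds_unique (hTu.mul_const z) ?_
      have h2 : (fun n => (toLinearMap T ∘ u) n * z) = fun n => u n * T z :=
        funext fun n => mul_comm' T (u n) z
      rw [h2]
      exact (mul_comm' T x z).symm ▸ hu.mul_const (T z)
    · refine tendsto_nhds_unique (hTu.const_mul z) ?_
      have h2 : (fun n => z * (toLinearMap T ∘ u) n) = fun n => T z * u n :=
        funext fun n => (mul_comm' T z (u n)).symm
      rw [h2]
      exact (mul_comm' T z x) ▸ hu.const_mul (T z)
  exact hg

/-- The multipliers of a proper Banach algebra as bounded operators. -/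
def toCLM : Multiplier A →ₗ[ℂ] (A →L[ℂ] A) where
  toFun T := ⟨toLinearMap T, continuous_of_completeSpace T⟩
  map_add' _ _ := rfl
  map_smul' _ _ := rfl

/-- The operator norm `‖T‖ = sup {‖T x‖ : ‖x‖ ≤ 1}` on `M(A)`, for `A` a proper Banach algebra. -/
def opNorm : Seminorm ℂ (Multiplier A) := (normSeminorm ℂ (A →L[ℂ] A)).comp toCLM

/-- The operator norm topology on `M(A)`, for `A` a proper Banach algebra. -/
instance : TopologicalSpace (Multiplier A) := TopologicalSpace.induced toCLM inferInstance

end Banach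

end Multiplier

/-! ### Uniform seminorms and the normed factors -/

section Uniform

variable {E : Type*} [NonUnitalRing E] [Module ℂ E]

variable (E) in
/-- A uniform seminorm on an algebra: a submultiplicative seminorm `p` with `p(x²) = p(x)²`. -/
structure UniformSeminorm extends Seminorm ℂ E where
  mul_le' : ∀ x y : E, toFun (x * y) ≤ toFun x * toFun y
  sq' : ∀ x : E, toFun (x * x) = toFun x ^ 2

namespace UniformSeminorm

instance : CoeFun (UniformSeminorm E) (fun _ => E → ℝ) := ⟨fun p => p.toSeminorm⟩

variable (p q r : UniformSeminorm E)

theorem mul_le (x y : E) : p (x * y) ≤ p x * p y := p.mul_le' x y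

theorem sq (x : E) : p (x * x) = p x ^ 2 := p.sq' x

/-- `ker p = {x : p x = 0}`. -/
def ker : Submodule ℂ E where
  carrier := {x | p x = 0}
  zero_mem' := map_zero p.toSeminorm
  add_mem' {x y} hx hy := le_antisymm
    ((map_add_le_add p.toSeminorm x y).trans (by rw [hx, hy, add_zero])) (apply_nonneg _ _)
  smul_mem' c x hx := by
    change p (c • x) = 0
    rw [map_smul_eq_mul, (show p x = 0 from hx), mul_zero]

theorem mem_ker {x : E} : x ∈ p.ker ↔ p x = 0 := Iff.rfl

/-- The factor `E_p = E / ker p`. -/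
def Factor : Type _ := E ⧸ p.ker

instance : AddCommGroup p.Factor := inferInstanceAs (AddCommGroup (E ⧸ p.ker))
instance : Module ℂ p.Factor := inferInstanceAs (Module ℂ (E ⧸ p.ker))

/-- The quotient map `x ↦ x + ker p`, as a linear map. -/
def mkₗ : E →ₗ[ℂ] p.Factor := p.ker.mkQ

theorem mkₗ_surjective : Function.Surjective p.mkₗ := p.ker.mkQ_surjective

theorem mkₗ_eq_iff {x y : E} : p.mkₗ x = p.mkₗ y ↔ p (x - y) = 0 :=
  Submodule.Quotient.eq p.ker

theorem apply_eq_of_sub {x y : E} (h : p (x - y) = 0) : p x = p y := by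
  have h1 : p x ≤ p (x - y) + p y := by
    simpa using map_add_le_add p.toSeminorm (x - y) y
  have h2 : p y ≤ p (y - x) + p x := by
    simpa using map_add_le_add p.toSeminorm (y - x) x
  rw [map_sub_rev p.toSeminorm y x] at h2
  linarith

theorem mul_sub_mul {x x' y y' : E} (hx : p (x - x') = 0) (hy : p (y - y') = 0) :
    p (x * y - x' * y') = 0 := by
  have h : x * y - x' * y' = (x - x') * y + x' * (y - y') := by
    rw [sub_mul, mul_sub]; abel
  refine le_antisymm ?_ (apply_nonneg _ _)
  rw [h]
  refine (map_add_le_add p.toSeminorm _ _).trans ?_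
  have h1 := p.mul_le (x - x') y
  have h2 := p.mul_le x' (y - y')
  rw [hx, zero_mul] at h1
  rw [hy, mul_zero] at h2
  linarith

instance : Mul p.Factor where
  mul := Quotient.map₂ (fun x y => x * y) (by
    intro x x' hx y y' hy
    have hx' := (Submodule.quotientRel_def p.ker).1 hx
    have hy' := (Submodule.quotientRel_def p.ker).1 hy
    exact (Submodule.quotientRel_def p.ker).2 (p.mul_sub_mul hx' hy'))

theorem mkₗ_mul (x y : E) : p.mkₗ (x * y) = p.mkₗ x * p.mkₗ y := rfl

instance : NonUnitalRing p.Factor where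
  left_distrib := p.mkₗ_surjective.forall₃.2 fun x y z => by
    rw [← map_add, ← mkₗ_mul, ← mkₗ_mul, ← mkₗ_mul, mul_add, map_add]
  right_distrib := p.mkₗ_surjective.forall₃.2 fun x y z => by
    rw [← map_add, ← mkₗ_mul, ← mkₗ_mul, ← mkₗ_mul, add_mul, map_add]
  zero_mul := p.mkₗ_surjective.forall.2 fun x => by
    rw [← map_zero p.mkₗ, ← mkₗ_mul, zero_mul]
  mul_zero := p.mkₗ_surjective.forall.2 fun x => by
    rw [← map_zero p.mkₗ, ← mkₗ_mul, mul_zero]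
  mul_assoc := p.mkₗ_surjective.forall₃.2 fun x y z => by
    rw [← mkₗ_mul, ← mkₗ_mul, ← mkₗ_mul, ← mkₗ_mul, mul_assoc]

/-- The quotient map `f_p : E → E_p`, a surjective algebra homomorphism. -/
def proj : E →ₙₐ[ℂ] p.Factor :=
  { p.mkₗ with
    map_zero' := map_zero p.mkₗ
    map_mul' := p.mkₗ_mul }

theorem proj_surjective : Function.Surjective p.proj := p.mkₗ_surjective

theorem proj_eq_iff {x y : E} : p.proj x = p.proj y ↔ p (x - y) = 0 := p.mkₗ_eq_iff

/-- The norm of `E_p`: `‖x + ker p‖ = p x`. -/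
def factorNorm : AddGroupNorm p.Factor where
  toFun := Quotient.lift p fun x y h =>
    p.apply_eq_of_sub ((Submodule.quotientRel_def p.ker).1 h)
  map_zero' := map_zero p.toSeminorm
  add_le' := p.proj_surjective.forall₂.2 fun x y => map_add_le_add p.toSeminorm x y
  neg' := p.proj_surjective.forall.2 fun x => map_neg_eq_map p.toSeminorm x
  eq_zero_of_map_eq_zero' := p.proj_surjective.forall.2 fun x hx => by
    rw [← map_zero p.proj, proj_eq_iff, sub_zero]
    exact hx

/-- The normed algebra structure of the factor `E_p`. -/
instance : NonUnitalNormedRing p.Factor :=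
  { AddGroupNorm.toNormedAddCommGroup p.factorNorm,
    (inferInstance : NonUnitalRing p.Factor) with
    norm_mul_le := p.proj_surjective.forall₂.2 fun x y => p.mul_le x y }

theorem norm_proj (x : E) : ‖p.proj x‖ = p x := rfl

instance : NormedSpace ℂ p.Factor where
  norm_smul_le c := p.proj_surjective.forall.2 fun x => by
    rw [← map_smul, norm_proj, norm_proj, map_smul_eq_mul]

instance [IsScalarTower ℂ E E] : IsScalarTower ℂ p.Factor p.Factor where
  smul_assoc c := p.proj_surjective.forall₂.2 fun x y => by
    simp only [smul_eq_mul, ← map_smul, ← map_mul, smul_mul_assoc]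

instance [SMulCommClass ℂ E E] : SMulCommClass ℂ p.Factor p.Factor where
  smul_comm c := p.proj_surjective.forall₂.2 fun x y => by
    simp only [smul_eq_mul, ← map_smul, ← map_mul, mul_smul_comm]

theorem factor_eq_zero_of_mul_self : ∀ y : p.Factor, y * y = 0 → y = 0 :=
  p.proj_surjective.forall.2 fun x hx => by
    have h : p (x * x) = 0 := by rw [← norm_proj, map_mul, hx, norm_zero]
    rw [sq] at h
    rw [← norm_eq_zero, norm_proj]
    exact pow_eq_zero_iff two_ne_zero |>.1 h

instance : IsProperAlgebra p.Factor := .of_mul_self p.factor_eq_zero_of_mul_self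

variable {p q}

/-- The connecting homomorphism `E_q → E_p`, `x + ker q ↦ x + ker p`, for `p ≤ q`. -/
def transition (h : p.toSeminorm ≤ q.toSeminorm) : q.Factor →ₙₐ[ℂ] p.Factor :=
  have hk : q.ker ≤ p.ker := fun x hx =>
    le_antisymm ((h x).trans (le_of_eq hx)) (apply_nonneg _ _)
  { q.ker.mapQ p.ker LinearMap.id hk with
    map_zero' := map_zero (q.ker.mapQ p.ker LinearMap.id hk)
    map_mul' := q.proj_surjective.forall₂.2 fun _ _ => rfl }

@[simp] theorem transition_proj (h : p.toSeminorm ≤ q.toSeminorm) (x : E) :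
    transition h (q.proj x) = p.proj x := rfl

theorem transition_surjective (h : p.toSeminorm ≤ q.toSeminorm) :
    Function.Surjective (transition h) :=
  p.proj_surjective.forall.2 fun x => ⟨q.proj x, rfl⟩

variable [IsScalarTower ℂ E E] [SMulCommClass ℂ E E]

/-- For `p ≤ q`, the connecting homomorphism `h : M(E_q) → M(E_p)`: if `f : E_q → E_p` is the
connecting homomorphism of the factors, `h(U)` is the multiplier with `h(U) ∘ f = f ∘ U`. -/
def multiplierTransition (h : p.toSeminorm ≤ q.toSeminorm) :
    Multiplier q.Factor →ₐ[ℂ] Multiplier p.Factor :=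
  Multiplier.pushforward (transition h) (transition_surjective h) p.factor_eq_zero_of_mul_self

variable (p)

/-- The map `M(E) → M(E_p)`, `T ↦ T_p`, where `T_p` is the multiplier with `T_p ∘ f_p = f_p ∘ T`. -/
def multiplierMk [IsProperAlgebra E] : Multiplier E →ₐ[ℂ] Multiplier p.Factor :=
  Multiplier.pushforward p.proj p.proj_surjective p.factor_eq_zero_of_mul_self

end UniformSeminorm

variable {Λ : Type*}

/-- `E`, with its given topology, is a (Hausdorff) uniform topological algebra with defining family
`p`: the uniform seminorms `p α` form a directed family and determine the topology of `E`. (All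
compatibilities of the topology with the algebra operations follow.) -/
structure IsUniformTopologicalAlgebra [TopologicalSpace E] (p : Λ → UniformSeminorm E) :
    Prop where
  nonempty : Nonempty Λ
  t2Space : T2Space E
  directed : Directed (· ≤ ·) fun α => (p α).toSeminorm
  withSeminorms : WithSeminorms fun α => (p α).toSeminorm

theorem IsUniformTopologicalAlgebra.isProperAlgebra [TopologicalSpace E]
    {p : Λ → UniformSeminorm E} (h : IsUniformTopologicalAlgebra p) : IsProperAlgebra E := by
  have := h.t2Space
  refine .of_mul_self fun x hx => ?_
  by_contra hne
  obtain ⟨α, hα⟩ := h.withSeminorms.separating_of_T1 x hne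
  apply hα
  have h2 := (p α).sq x
  rw [hx, map_zero] at h2
  exact pow_eq_zero_iff two_ne_zero |>.1 h2.symm

variable [IsScalarTower ℂ E E] [SMulCommClass ℂ E E]

/-- The projective limit of the system `M(E_β) → M(E_α)`, `p α ≤ p β`, inside the product algebra
`∏ M(E_α)`. When the `E_α` are complete it carries the topology induced from the product of the
operator norm topologies. -/
def multiplierLimit (p : Λ → UniformSeminorm E) :
    Subalgebra ℂ (∀ α, Multiplier (p α).Factor) where
  carrier := {U | ∀ (α β : Λ) (h : (p α).toSeminorm ≤ (p β).toSeminorm),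
    UniformSeminorm.multiplierTransition h (U β) = U α}
  mul_mem' hU hV α β h := by simp only [Pi.mul_apply, map_mul, hU α β h, hV α β h]
  add_mem' hU hV α β h := by simp only [Pi.add_apply, map_add, hU α β h, hV α β h]
  algebraMap_mem' c α β h := by simp only [Pi.algebraMap_apply, AlgHom.commutes]

/-- The seminorms `T ↦ ‖T_α‖` on `M(E)`, where `‖·‖` is the operator norm on `M(E_α)`. -/
def multiplierSeminorm [IsProperAlgebra E] (p : Λ → UniformSeminorm E)
    [∀ α, CompleteSpace (p α).Factor] : SeminormFamily ℂ (Multiplier E) Λ :=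
  fun α => Multiplier.opNorm.comp ((p α).multiplierMk).toLinearMap

/-- The seminorm topology on `M(E)`, determined by the seminorms `T ↦ ‖T_α‖`. -/
@[reducible] def multiplierTopology [IsProperAlgebra E] (p : Λ → UniformSeminorm E)
    [∀ α, CompleteSpace (p α).Factor] : TopologicalSpace (Multiplier E) :=
  (multiplierSeminorm p).moduleFilterBasis.topology

end Uniform

end

open Filter Topology

/-! A complete Hausdorff `E` is the projective limit of its factors: the seminorms separate points
(`eq_of_proj_eq`), and completeness lifts every compatible family in `∏ E_α` to a point of `E`
(`exists_proj_eq`). A multiplier `T` is therefore determined by its `T_α`, which gives injectivity.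
Conversely, for a compatible family `(U_α)` and each `x`, the elements `U_α (f_α x)` are compatible,
so they are the coordinates of a single element `t x`; the map `t` is a multiplier because the
defining identity can be checked in every factor.

When the factors are Banach algebras, each `T_α` is bounded by the closed graph theorem, and `p_α ∘
T = ‖T_α (f_α ·)‖` makes `T` continuous. The seminorms `‖T_α‖` define exactly the topology pulled
back from `∏ M(E_α)`, so the bijection is also inducing. -/

section MultiplierLimit

variable {E Λ : Type*} [NonUnitalRing E] [Module ℂ E] {p : Λ → UniformSeminorm E}

/-- In a complete uniform topological algebra, a compatible family of elements of the factors comes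
from an element of the algebra. -/
theorem IsUniformTopologicalAlgebra.exists_proj_eq [UniformSpace E] [IsUniformAddGroup E]
    [CompleteSpace E] (hE : IsUniformTopologicalAlgebra p) (y : ∀ α, (p α).Factor)
    (hy : ∀ (α β : Λ) (h : (p α).toSeminorm ≤ (p β).toSeminorm),
      UniformSeminorm.transition h (y β) = y α) :
    ∃ x : E, ∀ α, (p α).proj x = y α := by
  have := hE.nonempty
  let S : Λ → Set E := fun α => {x | (p α).proj x = y α}
  have hS : ∀ {α β}, (p α).toSeminorm ≤ (p β).toSeminorm → S β ⊆ S α := by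
    intro α β h x (hx : (p β).proj x = y β)
    change (p α).proj x = y α
    rw [← UniformSeminorm.transition_proj h, hx, hy α β h]
  have hdir : Directed (· ≥ ·) fun α => 𝓟 (S α) := fun α β => by
    obtain ⟨γ, hα, hβ⟩ := hE.directed α β
    exact ⟨γ, principal_mono.2 (hS hα), principal_mono.2 (hS hβ)⟩
  -- The filter generated by the fibres of the `f_α` over `y α`. They are nonempty since `f_α` is
  -- surjective, and directedness of the seminorms makes them a filter base. A limit of this filter
  -- is the element sought.
  let F : Filter E := ⨅ α, 𝓟 (S α)
  have hF : ∀ α, S α ∈ F := fun α => mem_iInf_of_mem α (mem_principal_self _)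
  have : F.NeBot := iInf_neBot_of_directed' hdir fun α =>
    principal_neBot_iff.2 ((p α).proj_surjective (y α))
  have hC : Cauchy F := by
    refine ⟨this, ?_⟩
    rw [uniformity_eq_comap_nhds_zero, ← tendsto_iff_comap, hE.withSeminorms.tendsto_nhds]
    intro α ε hε
    -- Two points of one fibre differ by an element of `ker p_α`, so the difference is exactly `0`
    -- for `p α`, whatever `ε` is.
    filter_upwards [prod_mem_prod (hF α) (hF α)] with z hz
    have h0 : p α (z.2 - z.1) = 0 := (p α).proj_eq_iff.1 (hz.2.trans hz.1.symm)
    rw [sub_zero]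
    exact h0.trans_lt hε
  obtain ⟨x, hx⟩ := CompleteSpace.complete hC
  refine ⟨x, fun α => ?_⟩
  obtain ⟨x', hx'⟩ := (p α).proj_surjective (y α)
  rw [← hx', UniformSeminorm.proj_eq_iff]
  -- By continuity `p α (z - x')` tends to `p α (x - x')` along `F`; but it vanishes on the fibre `S
  -- α`, so the limit is `0`.
  have hlim : Tendsto (fun z => p α (z - x')) F (𝓝 (p α (x - x'))) :=
    ((hE.withSeminorms.continuous_seminorm α).comp (continuous_id.sub continuous_const)).continuousAt
      |>.tendsto.mono_left hx
  refine tendsto_nhds_unique hlim (tendsto_const_nhds.congr' ?_)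
  filter_upwards [hF α] with z hz
  exact ((p α).proj_eq_iff.1 (Eq.trans hz hx'.symm)).symm

theorem IsUniformTopologicalAlgebra.eq_of_proj_eq [TopologicalSpace E]
    (hE : IsUniformTopologicalAlgebra p) {x y : E} (h : ∀ α, (p α).proj x = (p α).proj y) :
    x = y := by
  have := hE.t2Space
  by_contra hne
  obtain ⟨α, hα⟩ := hE.withSeminorms.separating_of_T1 (x - y) (sub_ne_zero.2 hne)
  exact hα ((p α).proj_eq_iff.1 (h α))

variable [IsScalarTower ℂ E E] [SMulCommClass ℂ E E]

theorem UniformSeminorm.multiplierMk_proj [IsProperAlgebra E] (q : UniformSeminorm E)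
    (T : Multiplier E) (x : E) : q.multiplierMk T (q.proj x) = q.proj (T x) :=
  Multiplier.pushforward_apply _ _ _ T x

theorem UniformSeminorm.multiplierTransition_transition {q r : UniformSeminorm E}
    (h : q.toSeminorm ≤ r.toSeminorm) (U : Multiplier r.Factor) (y : r.Factor) :
    multiplierTransition h U (transition h y) = transition h (U y) :=
  Multiplier.pushforward_apply _ _ _ U y

/-- Both multipliers are induced by `T` along the same surjection `E → E_r → E_q`. This puts `(T_α)`
in the projective limit. -/
theorem UniformSeminorm.multiplierTransition_multiplierMk [IsProperAlgebra E]
    {q r : UniformSeminorm E} (h : q.toSeminorm ≤ r.toSeminorm) (T : Multiplier E) :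
    multiplierTransition h (r.multiplierMk T) = q.multiplierMk T :=
  Multiplier.ext <| q.proj_surjective.forall.2 fun x => by
    rw [← transition_proj h, multiplierTransition_transition, multiplierMk_proj, transition_proj,
      transition_proj, multiplierMk_proj]

variable (p) in
/-- The homomorphism `M(E) → lim M(E_α)`, `T ↦ (T_α)`. -/
noncomputable def multiplierLimitMk [IsProperAlgebra E] : Multiplier E →ₐ[ℂ] multiplierLimit p :=
  (AlgHom.pi fun α => (p α).multiplierMk).codRestrict (multiplierLimit p)
    fun T _ _ h => UniformSeminorm.multiplierTransition_multiplierMk h T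

theorem IsUniformTopologicalAlgebra.multiplierLimitMk_injective [IsProperAlgebra E]
    [TopologicalSpace E] (hE : IsUniformTopologicalAlgebra p) :
    Function.Injective (multiplierLimitMk p) := fun S T h =>
  Multiplier.ext fun x => hE.eq_of_proj_eq fun α => by
    have hα : (p α).multiplierMk S = (p α).multiplierMk T := congrFun (congrArg Subtype.val h) α
    rw [← UniformSeminorm.multiplierMk_proj, hα, UniformSeminorm.multiplierMk_proj]

theorem IsUniformTopologicalAlgebra.multiplierLimitMk_surjective [IsProperAlgebra E]
    [UniformSpace E] [IsUniformAddGroup E] [CompleteSpace E]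
    (hE : IsUniformTopologicalAlgebra p) : Function.Surjective (multiplierLimitMk p) := by
  rintro ⟨U, hU⟩
  have hex : ∀ x : E, ∃ z : E, ∀ α, (p α).proj z = U α ((p α).proj x) := fun x =>
    hE.exists_proj_eq _ fun α β h => by
      rw [← UniformSeminorm.multiplierTransition_transition, hU α β h,
        UniformSeminorm.transition_proj]
  choose t ht using hex
  refine ⟨⟨t, fun x y => hE.eq_of_proj_eq fun α => ?_⟩, Subtype.ext <| funext fun α =>
    Multiplier.ext <| (p α).proj_surjective.forall.2 fun x => ?_⟩
  · rw [map_mul, map_mul, ht, ht, Multiplier.mul_comm']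
  · exact ((p α).multiplierMk_proj _ x).trans (ht x α)

theorem IsUniformTopologicalAlgebra.continuous_multiplier [IsProperAlgebra E]
    [TopologicalSpace E] (hE : IsUniformTopologicalAlgebra p)
    [∀ α, CompleteSpace (p α).Factor] (T : Multiplier E) : Continuous T := by
  have := hE.withSeminorms.topologicalAddGroup
  refine hE.withSeminorms.continuous_of_continuous_comp T.toLinearMap fun α => ?_
  -- The norm of the image of `x` is `p α x`, which tends to `0` as `x → 0`.
  have hproj : Continuous (p α).mkₗ :=
    continuous_of_continuousAt_zero (p α).mkₗ <| by
      rw [ContinuousAt, map_zero, tendsto_zero_iff_norm_tendsto_zero]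
      have h := (hE.withSeminorms.continuous_seminorm α).tendsto 0
      rwa [map_zero] at h
  have h := continuous_norm.comp
    ((Multiplier.continuous_of_completeSpace ((p α).multiplierMk T)).comp hproj)
  refine h.congr fun x => ?_
  exact congrArg norm ((p α).multiplierMk_proj T x)

theorem isInducing_multiplierLimitMk [IsProperAlgebra E] [∀ α, CompleteSpace (p α).Factor] :
    @IsInducing _ _ (multiplierTopology p) _ (multiplierLimitMk p) := by
  let L : Multiplier E →ₗ[ℂ] ∀ α, Multiplier (p α).Factor :=
    (AlgHom.pi fun α => (p α).multiplierMk).toLinearMap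
  -- A single norm is treated as a family over `Fin 1`; the product is then indexed by `Σ α, Fin 1`,
  -- which `Equiv.sigmaUnique` identifies with `Λ`.
  have hnorm : ∀ α, WithSeminorms fun _ : Fin 1 =>
      (Multiplier.opNorm : Seminorm ℂ (Multiplier (p α).Factor)) := fun α =>
    Multiplier.toCLM.withSeminorms_induced
      (norm_withSeminorms ℂ ((p α).Factor →L[ℂ] (p α).Factor))
  let t : TopologicalSpace (Multiplier E) := .induced L inferInstance
  have hind : WithSeminorms (multiplierSeminorm p) :=
    (L.withSeminorms_induced (withSeminorms_pi hnorm)).congr_equiv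
      (Equiv.sigmaUnique Λ fun _ => Fin 1).symm
  refine @IsInducing.mk _ _ (multiplierTopology p) _ _ ?_
  refine hind.topology_eq_withSeminorms.symm.trans ?_
  -- The limit has the subspace topology, and `L` is `multiplierLimitMk p` followed by the inclusion
  -- into the product.
  exact (induced_compose (f := multiplierLimitMk p) (g := Subtype.val)).symm

end MultiplierLimit

theorem theorem2p9 {E Λ : Type*} [NonUnitalRing E] [Module ℂ E] [IsScalarTower ℂ E E]
    [SMulCommClass ℂ E E] [UniformSpace E] [IsUniformAddGroup E] [CompleteSpace E]
    (p : Λ → UniformSeminorm E) (hE : IsUniformTopologicalAlgebra p) :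
    haveI : IsProperAlgebra E := hE.isProperAlgebra
    ∃ φ : Multiplier E ≃ₐ[ℂ] multiplierLimit p,
      (∀ (T : Multiplier E) (α : Λ),
        (φ T : ∀ α, Multiplier (p α).Factor) α = (p α).multiplierMk T) ∧
      ∀ [∀ α, CompleteSpace (p α).Factor],
        (∀ T : Multiplier E, Continuous T) ∧
        letI : TopologicalSpace (Multiplier E) := multiplierTopology p
        IsHomeomorph φ := by
  have : IsProperAlgebra E := hE.isProperAlgebra
  have hbij : Function.Bijective (multiplierLimitMk p) :=
    ⟨hE.multiplierLimitMk_injective, hE.multiplierLimitMk_surjective⟩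
  refine ⟨AlgEquiv.ofBijective (multiplierLimitMk p) hbij, fun _ _ => rfl, ?_⟩
  intro hc
  refine ⟨hE.continuous_multiplier, ?_⟩
  let _ : TopologicalSpace (Multiplier E) := multiplierTopology p
  exact isHomeomorph_iff_isEmbedding_surjective.2
    ⟨⟨isInducing_multiplierLimitMk, hbij.1⟩, hbij.2⟩
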